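/- Let $q,h\in\mathbb{C}$ with $0<|q|<1$, put $a=q^{1-h}$, and assume $|q/a|<1$ and $|a|<1$. Write $(z;q)_\infty=\prod_{j\ge 0}(1-zq^j)$ and $(cz^{\pm1};q)_\infty=(cz;q)_\infty(cz^{-1};q)_\infty$. Let $q^{1/2}$ and $a^{1/2}$ be any choices of square roots of $q$ and $a$, put $a^{-1/2}=1/a^{1/2}$, and for $k\in\mathbb{Z}$ put $a^{|k|/2}=(a^{1/2})^{|k|}$ and $q^{1/2+|k|/2}=(q^{1/2})^{1+|k|}$. Let $\mathbb{T}$ be the positively oriented unit circle. Then in $$I_{e,N_f=1;h}=\sum_{k\in\mathbb{Z}}a^{|k|/2}\int_{\mathbb{T}}\frac{(a^{1/2}q^{1/2+|k|/2}z^{\pm1};q)_\infty}{(a^{-1/2}q^{1/2+|k|/2}z^{\pm1};q)_\infty}\,\frac{dz}{2\pi i z}$$ every integrand is well defined (its denominator has no zero on $\mathbb{T}$) and continuous on $\mathbb{T}$, the series converges absolutely, and $$I_{e,N_f=1;h}=\frac{(a;q)_\infty}{(q/a;q)_\infty}\,\frac{(q/a^{1/2};q)_\infty^2}{(a^{1/2};q)_\infty^2},$$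 where the denominators on the right-hand side are non-zero. -/

import Mathlib

noncomputable section

/-- The infinite `q`-product `(z; q)_∞ = ∏_{j ≥ 0} (1 - z q ^ j)`
(absolutely convergent for `‖q‖ < 1`). -/
def qPochInf (z q : ℂ) : ℂ := ∏' j : ℕ, (1 - z * q ^ j)

/-- The shorthand `(c z^{±1}; q)_∞ = (c z; q)_∞ (c z⁻¹; q)_∞`. -/
def qPochInfPM (c z q : ℂ) : ℂ := qPochInf (c * z) q * qPochInf (c * z⁻¹) q

/-- The function
`(a^{1/2} q^{1/2+|k|/2} z^{±1}; q)_∞ / (a^{-1/2} q^{1/2+|k|/2} z^{±1}; q)_∞`,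
where `r` stands for the chosen square root `q^{1/2}` and `s` for the chosen
square root `a^{1/2}`; thus `q^{1/2+|k|/2} = r ^ (1 + |k|)`. -/
def electricIntegrand (q r s : ℂ) (k : ℤ) (z : ℂ) : ℂ :=
  qPochInfPM (s * r ^ (1 + k.natAbs)) z q / qPochInfPM (s⁻¹ * r ^ (1 + k.natAbs)) z q

/-- The summand with index `k` of the electric index: `a^{|k|/2}` times the integral of the
integrand over the positively oriented unit circle against `dz / (2 π i z)`. -/
def electricTerm (q r s : ℂ) (k : ℤ) : ℂ :=
  s ^ k.natAbs *
    ∮ z in C(0, 1), electricIntegrand q r s k z / (2 * (Real.pi : ℂ) * Complex.I * z)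

/-- The electric index, with `r = q^{1/2}` and `s = a^{1/2}`. -/
def electricIndex (q r s : ℂ) : ℂ := ∑' k : ℤ, electricTerm q r s k

/-- The mirror index
`(a; q)_∞ / (q/a; q)_∞ * (q/a^{1/2}; q)_∞² / (a^{1/2}; q)_∞²`, with `s = a^{1/2}`. -/
def mirrorIndex (q a s : ℂ) : ℂ :=
  qPochInf a q / qPochInf (q / a) q * (qPochInf (q / s) q ^ 2 / qPochInf s q ^ 2)

end

/-! Write s = a^{1/2}. On the unit circle the q-binomial theorem (`tsum_qBinomCoeff_mul_pow`)
expands each integrand as a power series in z times the same series in z⁻¹, so its integral is the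
sum of the squared coefficients (`hasSum_circleIntegral_mul_inv`). In these sums k survives only as
(s qⁿ)^|k|. Summing over k first (`hasSum_electricIndex`) turns the index into ∑ₙ ((a;q)ₙ/(q;q)ₙ)²
(q/a)ⁿ (1 + s qⁿ)/(1 - s qⁿ).

Up to the factor 1 - s, this is a very-well-poised ₆φ₅ series F(x) at x = s⁻¹, where x is the
reciprocal of one numerator parameter. Telescoping relates F(x) to F(qx)
(`tsum_wellPoisedTerm_contiguous`), and iteration gives F(x) as a quotient of q-products times F(0)
(`tsum_wellPoisedTerm_eq`). At x = 1 the series stops after its first term, which fixes F(0); then x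
= s⁻¹ gives the closed form (`tsum_qBinomCoeff_sq_mul`). -/

open Filter Topology

/-! ### Finite and infinite q-products: limits, zeros, uniform bounds -/

/-- The finite `q`-product `(z; q)_n = ∏_{j < n} (1 - z q ^ j)`. -/
noncomputable def qPochFin (z q : ℂ) (n : ℕ) : ℂ := ∏ j ∈ Finset.range n, (1 - z * q ^ j)

@[simp] lemma qPochFin_zero (z q : ℂ) : qPochFin z q 0 = 1 := by simp [qPochFin]

lemma qPochFin_succ (z q : ℂ) (n : ℕ) :
    qPochFin z q (n + 1) = qPochFin z q n * (1 - z * q ^ n) := by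
  simp [qPochFin, Finset.prod_range_succ]

lemma qPochFin_succ' (z q : ℂ) (n : ℕ) :
    qPochFin z q (n + 1) = (1 - z) * qPochFin (z * q) q n := by
  simp [qPochFin, Finset.prod_range_succ', pow_succ', mul_comm, mul_assoc]

lemma summable_norm_mul_pow {q : ℂ} (hq : ‖q‖ < 1) (z : ℂ) :
    Summable fun j : ℕ => ‖-(z * q ^ j)‖ := by
  simpa using (summable_geometric_of_lt_one (norm_nonneg q) hq).mul_left ‖z‖

lemma tendsto_qPochFin {q : ℂ} (hq : ‖q‖ < 1) (z : ℂ) :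
    Tendsto (qPochFin z q) atTop (𝓝 (qPochInf z q)) := by
  have h := (multipliable_one_add_of_summable (summable_norm_mul_pow hq z)).hasProd.tendsto_prod_nat
  simp only [← sub_eq_add_neg] at h
  exact h

lemma one_sub_mul_pow_ne_zero {q z : ℂ} (hq : ‖q‖ < 1) (hz : ‖z‖ < 1) (j : ℕ) :
    1 - z * q ^ j ≠ 0 := by
  intro h
  have h1 : ‖z * q ^ j‖ = 1 := by rw [← sub_eq_zero.1 h, norm_one]
  have h2 : ‖q‖ ^ j ≤ 1 := pow_le_one₀ (norm_nonneg _) hq.le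
  rw [norm_mul, norm_pow] at h1
  nlinarith [norm_nonneg z, norm_nonneg q]

lemma qPochFin_ne_zero {q z : ℂ} (hq : ‖q‖ < 1) (hz : ‖z‖ < 1) (n : ℕ) :
    qPochFin z q n ≠ 0 :=
  Finset.prod_ne_zero_iff.2 fun j _ => one_sub_mul_pow_ne_zero hq hz j

lemma qPochInf_ne_zero {q z : ℂ} (hq : ‖q‖ < 1) (hz : ‖z‖ < 1) : qPochInf z q ≠ 0 := by
  have := tprod_one_add_ne_zero_of_summable (f := fun j : ℕ => -(z * q ^ j))
    (fun j => by simpa [sub_eq_add_neg] using one_sub_mul_pow_ne_zero hq hz j)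
    (summable_norm_mul_pow hq z)
  simpa [qPochInf, sub_eq_add_neg] using this

lemma qPochInf_eq_mul {q : ℂ} (hq : ‖q‖ < 1) (z : ℂ) :
    qPochInf z q = (1 - z) * qPochInf (z * q) q := by
  refine tendsto_nhds_unique ((tendsto_add_atTop_iff_nat 1).2 (tendsto_qPochFin hq z)) ?_
  simp only [qPochFin_succ']
  exact (tendsto_qPochFin hq _).const_mul _

lemma continuous_qPochInf {q : ℂ} (hq : ‖q‖ < 1) : Continuous fun z => qPochInf z q := by
  refine continuous_iff_continuousAt.2 fun z => ?_
  have h := tendsto_tprod_one_add_of_dominated_convergence (𝓕 := 𝓝 z)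
    (f := fun w (j : ℕ) => -(w * q ^ j)) (g := fun j => -(z * q ^ j))
    (bound := fun j => (‖z‖ + 1) * ‖q‖ ^ j)
    ((summable_geometric_of_lt_one (norm_nonneg q) hq).mul_left _)
    (fun k => (Continuous.tendsto (by fun_prop) z))
    (by
      filter_upwards [(continuous_norm.tendsto z).eventually_le_const (lt_add_one ‖z‖)] with w hw k
      simpa using mul_le_mul_of_nonneg_right hw (by positivity))
  simpa [ContinuousAt, qPochInf, sub_eq_add_neg] using h

/-- A product of factors of norm at most `1 + C ρ ^ j` is bounded independently of its length. -/
lemma norm_prod_range_le_exp {ρ C : ℝ} (hρ0 : 0 ≤ ρ) (hρ : ρ < 1) (hC : 0 ≤ C) {f : ℕ → ℂ}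
    (hf : ∀ j, ‖f j‖ ≤ 1 + C * ρ ^ j) (n : ℕ) :
    ‖∏ j ∈ Finset.range n, f j‖ ≤ Real.exp (C * (1 - ρ)⁻¹) := by
  rw [norm_prod]
  calc ∏ j ∈ Finset.range n, ‖f j‖ ≤ ∏ j ∈ Finset.range n, (1 + C * ρ ^ j) :=
        Finset.prod_le_prod (fun _ _ => norm_nonneg _) fun j _ => hf j
    _ ≤ Real.exp (∑ j ∈ Finset.range n, C * ρ ^ j) :=
        Real.prod_one_add_le_exp_sum _ fun j => by positivity
    _ ≤ _ := by
        rw [← Finset.mul_sum, ← tsum_geometric_of_lt_one hρ0 hρ]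
        gcongr
        exact (summable_geometric_of_lt_one hρ0 hρ).sum_le_tsum _ fun _ _ => by positivity

lemma norm_qPochFin_le {q : ℂ} (hq : ‖q‖ < 1) (z : ℂ) (n : ℕ) :
    ‖qPochFin z q n‖ ≤ Real.exp (‖z‖ * (1 - ‖q‖)⁻¹) :=
  norm_prod_range_le_exp (norm_nonneg q) hq (norm_nonneg z)
    (fun j => (norm_sub_le _ _).trans (by simp)) n

lemma norm_inv_qPochFin_le {q z : ℂ} {R : ℝ} (hq : ‖q‖ < 1) (hz : ‖z‖ ≤ R) (hR : R < 1) (n : ℕ) :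
    ‖(qPochFin z q n)⁻¹‖ ≤ Real.exp ((1 - R)⁻¹ * (1 - ‖q‖)⁻¹) := by
  have hR' : 0 < 1 - R := by linarith
  rw [qPochFin, ← Finset.prod_inv_distrib]
  refine norm_prod_range_le_exp (norm_nonneg q) hq (by positivity) (fun j => ?_) n
  have hqj : ‖q‖ ^ j ≤ 1 := pow_le_one₀ (norm_nonneg _) hq.le
  have hqj0 : 0 ≤ ‖q‖ ^ j := by positivity
  have h1 : 1 - R * ‖q‖ ^ j ≤ ‖1 - z * q ^ j‖ := by
    have h := norm_sub_norm_le (1 : ℂ) (z * q ^ j)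
    rw [norm_one, norm_mul, norm_pow] at h
    nlinarith
  have hR0 : 0 ≤ R := (norm_nonneg z).trans hz
  have h2 : 1 - R ≤ 1 - R * ‖q‖ ^ j := by nlinarith
  rw [norm_inv]
  refine (inv_anti₀ (hR'.trans_le h2) h1).trans ?_
  rw [inv_le_iff_one_le_mul₀ (hR'.trans_le h2), inv_mul_eq_div, ← sub_nonneg]
  -- With t = ‖q‖ʲ, this is 1/(1 - Rt) ≤ 1 + t/(1 - R) with denominators cleared.
  have : (1 + ‖q‖ ^ j / (1 - R)) * (1 - R * ‖q‖ ^ j) - 1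
      = ‖q‖ ^ j * ((1 - R) * (1 - R) + R * (1 - ‖q‖ ^ j)) / (1 - R) := by
    field_simp
    ring
  rw [this]
  have : 0 ≤ 1 - ‖q‖ ^ j := by linarith
  positivity

/-! ### The q-binomial series -/

/-- The coefficient `(c; q)_n / (q; q)_n` of the `q`-binomial series. -/
noncomputable def qBinomCoeff (c q : ℂ) (n : ℕ) : ℂ := qPochFin c q n / qPochFin q q n

@[simp] lemma qBinomCoeff_zero (c q : ℂ) : qBinomCoeff c q 0 = 1 := by simp [qBinomCoeff]

lemma qBinomCoeff_succ (c q : ℂ) (n : ℕ) :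
    qBinomCoeff c q (n + 1) = qBinomCoeff c q n * ((1 - c * q ^ n) / (1 - q ^ (n + 1))) := by
  rw [qBinomCoeff, qPochFin_succ, qPochFin_succ, ← pow_succ', mul_div_mul_comm, qBinomCoeff]

lemma exists_norm_qBinomCoeff_le {q : ℂ} (hq : ‖q‖ < 1) (c : ℂ) :
    ∃ B, 0 < B ∧ ∀ n, ‖qBinomCoeff c q n‖ ≤ B := by
  refine ⟨Real.exp (‖c‖ * (1 - ‖q‖)⁻¹) * Real.exp ((1 - ‖q‖)⁻¹ * (1 - ‖q‖)⁻¹), by positivity,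
    fun n => ?_⟩
  rw [qBinomCoeff, div_eq_mul_inv, norm_mul]
  exact mul_le_mul (norm_qPochFin_le hq c n) (norm_inv_qPochFin_le hq le_rfl hq n)
    (norm_nonneg _) (by positivity)

lemma one_sub_pow_succ_ne_zero {q : ℂ} (hq : ‖q‖ < 1) (n : ℕ) : 1 - q ^ (n + 1) ≠ 0 := by
  rw [pow_succ']
  exact one_sub_mul_pow_ne_zero hq hq n

lemma summable_norm_qBinomCoeff_mul_pow {q x : ℂ} (hq : ‖q‖ < 1) (hx : ‖x‖ < 1) (c : ℂ) :
    Summable fun n => ‖qBinomCoeff c q n * x ^ n‖ := by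
  obtain ⟨B, hB0, hB⟩ := exists_norm_qBinomCoeff_le hq c
  refine Summable.of_nonneg_of_le (fun _ => norm_nonneg _) (fun n => ?_)
    ((summable_geometric_of_lt_one (norm_nonneg x) hx).mul_left B)
  rw [norm_mul, norm_pow]
  exact mul_le_mul_of_nonneg_right (hB n) (by positivity)

/-- The `q`-binomial theorem. -/
theorem tsum_qBinomCoeff_mul_pow {q x : ℂ} (hq : ‖q‖ < 1) (hx : ‖x‖ < 1) (c : ℂ) :
    ∑' n, qBinomCoeff c q n * x ^ n = qPochInf (c * x) q / qPochInf x q := by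
  set f : ℂ → ℂ := fun y => ∑' n, qBinomCoeff c q n * y ^ n with hf
  have hsum : ∀ y : ℂ, ‖y‖ < 1 → Summable fun n => qBinomCoeff c q n * y ^ n := fun y hy =>
    (summable_norm_qBinomCoeff_mul_pow hq hy c).of_norm
  have hpow : ∀ m : ℕ, ‖x * q ^ m‖ ≤ ‖x‖ := fun m => by
    rw [norm_mul, norm_pow]
    exact mul_le_of_le_one_right (norm_nonneg _) (pow_le_one₀ (norm_nonneg _) hq.le)
  -- The coefficient recursion (1 - qⁿ⁺¹)uₙ₊₁ = (1 - c qⁿ)uₙ, times yⁿ⁺¹ and summed, is this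
  -- q-difference equation; iterating it drives the argument to 0.
  have hfun : ∀ y : ℂ, ‖y‖ < 1 → f y * (1 - y) = (1 - c * y) * f (y * q) := by
    intro y hy
    have hyq : ‖y * q‖ < 1 := by
      rw [norm_mul]; nlinarith [norm_nonneg y, norm_nonneg q]
    have h1 := hsum y hy
    have h2 := hsum _ hyq
    have e1 : f y = 1 + ∑' n, qBinomCoeff c q (n + 1) * y ^ (n + 1) := by
      simp only [hf]; rw [h1.tsum_eq_zero_add]; simp
    have e2 : f (y * q) = 1 + ∑' n, qBinomCoeff c q (n + 1) * (y * q) ^ (n + 1) := by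
      simp only [hf]; rw [h2.tsum_eq_zero_add]; simp
    have key : ∑' n, qBinomCoeff c q (n + 1) * y ^ (n + 1)
        - ∑' n, qBinomCoeff c q (n + 1) * (y * q) ^ (n + 1) = y * f y - c * y * f (y * q) := by
      rw [← ((summable_nat_add_iff 1).2 h1).tsum_sub ((summable_nat_add_iff 1).2 h2)]
      simp only [hf]
      rw [← tsum_mul_left, ← tsum_mul_left, ← (h1.mul_left y).tsum_sub (h2.mul_left (c * y))]
      refine tsum_congr fun n => ?_
      rw [qBinomCoeff_succ]
      have := one_sub_pow_succ_ne_zero hq n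
      field_simp
      ring
    linear_combination (-1) * e2 + e1 + key
  have hiter : ∀ m : ℕ, f x * qPochFin x q m = qPochFin (c * x) q m * f (x * q ^ m) := by
    intro m
    induction m with
    | zero => simp
    | succ m ih =>
      rw [qPochFin_succ, qPochFin_succ, ← mul_assoc, ih, mul_assoc,
        hfun _ ((hpow m).trans_lt hx), pow_succ]
      ring_nf
  have hlim : Tendsto (fun m : ℕ => f (x * q ^ m)) atTop (𝓝 (f 0)) := by
    obtain ⟨B, hB0, hB⟩ := exists_norm_qBinomCoeff_le hq c
    refine tendsto_tsum_of_dominated_convergence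
      ((summable_geometric_of_lt_one (norm_nonneg x) hx).mul_left B) (fun n => ?_)
      (Eventually.of_forall fun m n => ?_)
    · have := (tendsto_pow_atTop_nhds_zero_of_norm_lt_one hq).const_mul x
      rw [mul_zero] at this
      exact (this.pow n).const_mul _
    · rw [norm_mul, norm_pow]
      exact mul_le_mul (hB n) (pow_le_pow_left₀ (norm_nonneg _) (hpow m) n) (by positivity) hB0.le
  have hf0 : f 0 = 1 := by
    simp only [hf]
    rw [tsum_eq_single 0 (fun n hn => by simp [hn])]
    simp
  rw [eq_div_iff (qPochInf_ne_zero hq hx)]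
  refine tendsto_nhds_unique ((tendsto_qPochFin hq x).const_mul (f x)) ?_
  simp only [hiter]
  simpa [hf0] using (tendsto_qPochFin hq (c * x)).mul hlim

/-! ### A very-well-poised series and its closed form -/

/-- The factor `((a; q)_n / (q; q)_n)² ∏_{j < n} (x - q ^ j) / (a q x; q)_n (q / s) ^ n`, with
`a = s ^ 2`, of the summand of a very-well-poised series in the variable `x`. -/
noncomputable def wellPoisedCore (q s x : ℂ) (n : ℕ) : ℂ :=
  qBinomCoeff (s ^ 2) q n ^ 2 * (∏ j ∈ Finset.range n, (x - q ^ j)) *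
    (qPochFin (s ^ 2 * q * x) q n)⁻¹ * (q / s) ^ n

/-- The summand of a very-well-poised `₆φ₅` series in the variable `x`. -/
noncomputable def wellPoisedTerm (q s x : ℂ) (n : ℕ) : ℂ :=
  (1 + s * q ^ n) * wellPoisedCore q s x n

section
variable {q s x : ℂ}

lemma norm_sq_mul_mul_le (hs0 : s ≠ 0) (hx : ‖x‖ ≤ ‖s‖⁻¹) : ‖s ^ 2 * q * x‖ ≤ ‖s‖ * ‖q‖ := by
  have hs : 0 < ‖s‖ := norm_pos_iff.2 hs0
  rw [norm_mul, norm_mul, norm_pow]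
  calc ‖s‖ ^ 2 * ‖q‖ * ‖x‖ ≤ ‖s‖ ^ 2 * ‖q‖ * ‖s‖⁻¹ := by gcongr
    _ = ‖s‖ * ‖q‖ := by field_simp

/-- Each s(x - qʲ) has norm at most 1 + ‖s‖‖q‖ʲ, so the product is O(‖s‖⁻ⁿ), and (q/s)ⁿ supplies the
rest. Uniformity in x permits dominated convergence along x qᵐ → 0. -/
lemma exists_norm_wellPoisedCore_le (hq : ‖q‖ < 1) (hs0 : s ≠ 0) (hs1 : ‖s‖ < 1) :
    ∃ C, 0 < C ∧ ∀ x : ℂ, ‖x‖ ≤ ‖s‖⁻¹ → ∀ n, ‖wellPoisedCore q s x n‖ ≤ C * ‖q / s ^ 2‖ ^ n := by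
  obtain ⟨B, hB0, hB⟩ := exists_norm_qBinomCoeff_le hq (s ^ 2)
  have hs : 0 < ‖s‖ := norm_pos_iff.2 hs0
  have hR : ‖s‖ * ‖q‖ < 1 := by nlinarith [norm_nonneg q]
  refine ⟨B ^ 2 * Real.exp (‖s‖ * (1 - ‖q‖)⁻¹) *
    Real.exp ((1 - ‖s‖ * ‖q‖)⁻¹ * (1 - ‖q‖)⁻¹), by positivity, fun x hx n => ?_⟩
  have hP : ‖∏ j ∈ Finset.range n, (x - q ^ j)‖ ≤ Real.exp (‖s‖ * (1 - ‖q‖)⁻¹) * ‖s‖⁻¹ ^ n := by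
    have h := norm_prod_range_le_exp (norm_nonneg q) hq hs.le (f := fun j => s * (x - q ^ j))
      (fun j => by
        rw [norm_mul]
        have h1 : ‖x - q ^ j‖ ≤ ‖s‖⁻¹ + ‖q‖ ^ j := by
          refine (norm_sub_le _ _).trans ?_
          rw [norm_pow]
          gcongr
        calc ‖s‖ * ‖x - q ^ j‖ ≤ ‖s‖ * (‖s‖⁻¹ + ‖q‖ ^ j) := by gcongr
          _ = 1 + ‖s‖ * ‖q‖ ^ j := by field_simp) n
    rw [Finset.prod_mul_distrib, norm_mul, Finset.prod_const, Finset.card_range, norm_pow] at h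
    rw [inv_pow, ← div_eq_mul_inv, le_div_iff₀ (by positivity), mul_comm]
    exact h
  have hI := norm_inv_qPochFin_le hq (norm_sq_mul_mul_le (q := q) hs0 hx) hR n
  rw [wellPoisedCore, norm_mul, norm_mul, norm_mul, norm_pow, norm_pow]
  calc _ ≤ B ^ 2 * (Real.exp (‖s‖ * (1 - ‖q‖)⁻¹) * ‖s‖⁻¹ ^ n) *
        Real.exp ((1 - ‖s‖ * ‖q‖)⁻¹ * (1 - ‖q‖)⁻¹) * ‖q / s‖ ^ n := by
        gcongr
        exact hB n
    _ = _ := by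
        rw [norm_div, norm_div, norm_pow, div_pow, div_pow, ← pow_mul, inv_pow]
        field_simp
        ring

lemma exists_norm_wellPoisedTerm_le (hq : ‖q‖ < 1) (hs0 : s ≠ 0) (hs1 : ‖s‖ < 1) :
    ∃ C, 0 < C ∧ ∀ x : ℂ, ‖x‖ ≤ ‖s‖⁻¹ → ∀ n, ‖wellPoisedTerm q s x n‖ ≤ C * ‖q / s ^ 2‖ ^ n := by
  obtain ⟨C, hC0, hC⟩ := exists_norm_wellPoisedCore_le hq hs0 hs1
  refine ⟨2 * C, by positivity, fun x hx n => ?_⟩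
  have hqn : ‖q‖ ^ n ≤ 1 := pow_le_one₀ (norm_nonneg _) hq.le
  have h1 : ‖1 + s * q ^ n‖ ≤ 2 := by
    refine (norm_add_le _ _).trans ?_
    rw [norm_one, norm_mul, norm_pow]
    nlinarith [norm_nonneg s, norm_nonneg q]
  rw [wellPoisedTerm, norm_mul, mul_assoc]
  exact mul_le_mul h1 (hC x hx n) (norm_nonneg _) (by norm_num)

lemma summable_wellPoisedTerm (hq : ‖q‖ < 1) (hs0 : s ≠ 0) (hs1 : ‖s‖ < 1) (hqs : ‖q / s ^ 2‖ < 1)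
    (hx : ‖x‖ ≤ ‖s‖⁻¹) : Summable (wellPoisedTerm q s x) := by
  obtain ⟨C, hC0, hC⟩ := exists_norm_wellPoisedTerm_le hq hs0 hs1
  exact Summable.of_norm_bounded
    ((summable_geometric_of_lt_one (norm_nonneg _) hqs).mul_left C) (hC x hx)

lemma prod_sub_pow_mul_self (q x : ℂ) (n : ℕ) :
    ∏ j ∈ Finset.range (n + 1), (x * q - q ^ j) =
      (q * x - 1) * q ^ n * ∏ j ∈ Finset.range n, (x - q ^ j) := by
  rw [Finset.prod_range_succ']
  have : ∀ j ∈ Finset.range n, x * q - q ^ (j + 1) = q * (x - q ^ j) := fun j _ => by ring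
  rw [Finset.prod_congr rfl this, Finset.prod_mul_distrib]
  simp
  ring

/-- The telescoping identity behind the contiguous relation `x ↦ q x`. -/
lemma sum_range_wellPoisedTerm (hq : ‖q‖ < 1) (hs0 : s ≠ 0) (hs1 : ‖s‖ < 1)
    (hx : ‖x‖ ≤ ‖s‖⁻¹) (N : ℕ) :
    ∑ n ∈ Finset.range (N + 1),
      ((1 - s ^ 2 * q * x) * (1 - q * x / s) * wellPoisedTerm q s x n -
        (1 - q * x) * (1 - q * s * x) * wellPoisedTerm q s (x * q) n) =
      -x * (1 - s ^ 2 * q * x) * (q / s) * (1 - s ^ 2 * q ^ N) ^ 2 *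
        (1 - s ^ 2 * q * x * q ^ N)⁻¹ * wellPoisedCore q s x N := by
  have hz : ‖s ^ 2 * q * x‖ < 1 := (norm_sq_mul_mul_le hs0 hx).trans_lt (by
    nlinarith [norm_nonneg q, norm_pos_iff.2 hs0])
  have hne := one_sub_mul_pow_ne_zero hq hz
  induction N with
  | zero =>
    have h0 : 1 - s ^ 2 * q * x ≠ 0 := by simpa using hne 0
    simp [wellPoisedTerm, wellPoisedCore]
    field_simp
    ring
  | succ N ih =>
    rw [Finset.sum_range_succ, ih]
    -- Shifting x to xq moves the q-product by one factor, so both series can be written over (a q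
    -- x; q)_N and what remains is a rational identity.
    have hshift : qPochFin (s ^ 2 * q * (x * q)) q (N + 1) * (1 - s ^ 2 * q * x) =
        qPochFin (s ^ 2 * q * x) q N * (1 - s ^ 2 * q * x * q ^ N) *
          (1 - s ^ 2 * q * x * q ^ (N + 1)) := by
      rw [← qPochFin_succ, ← qPochFin_succ, qPochFin_succ' _ _ (N + 1)]
      ring_nf
    have hinv : (qPochFin (s ^ 2 * q * (x * q)) q (N + 1))⁻¹ = (1 - s ^ 2 * q * x) *
        (qPochFin (s ^ 2 * q * x) q N)⁻¹ * (1 - s ^ 2 * q * x * q ^ N)⁻¹ *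
          (1 - s ^ 2 * q * x * q ^ (N + 1))⁻¹ := by
      have h0 : 1 - s ^ 2 * q * x ≠ 0 := by simpa using hne 0
      have h1 := hne N
      have h2 := hne (N + 1)
      have h3 := qPochFin_ne_zero hq hz N
      rw [inv_eq_iff_eq_inv, ← mul_left_inj' h0, hshift]
      field_simp
    simp only [wellPoisedTerm, wellPoisedCore, qBinomCoeff_succ, prod_sub_pow_mul_self, hinv]
    rw [qPochFin_succ, Finset.prod_range_succ]
    have h1 := hne N
    have h2 := hne (N + 1)
    have h3 := qPochFin_ne_zero hq hz N
    have h4 := one_sub_pow_succ_ne_zero hq N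
    generalize qPochFin (s ^ 2 * q * x) q N = A at *
    generalize ∏ j ∈ Finset.range N, (x - q ^ j) = P at *
    generalize qBinomCoeff (s ^ 2) q N = u at *
    simp only [pow_succ q N, pow_succ (q / s) N] at *
    generalize (q / s) ^ N = v at *
    generalize q ^ N = y at *
    clear ih hshift hinv hne
    generalize hd1 : 1 - s ^ 2 * q * x * y = d1 at *
    generalize hd2 : 1 - s ^ 2 * q * x * (y * q) = d2 at *
    generalize hd4 : 1 - y * q = d4 at *
    field_simp
    subst hd1 hd2 hd4
    ring

/-- The contiguous relation `x ↦ q x` for the very-well-poised series. -/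
lemma tsum_wellPoisedTerm_contiguous (hq : ‖q‖ < 1) (hs0 : s ≠ 0) (hs1 : ‖s‖ < 1)
    (hqs : ‖q / s ^ 2‖ < 1) (hx : ‖x‖ ≤ ‖s‖⁻¹) :
    (1 - s ^ 2 * q * x) * (1 - q * x / s) * ∑' n, wellPoisedTerm q s x n =
      (1 - q * x) * (1 - q * s * x) * ∑' n, wellPoisedTerm q s (x * q) n := by
  have hxq : ‖x * q‖ ≤ ‖s‖⁻¹ := by
    rw [norm_mul]
    exact (mul_le_of_le_one_right (norm_nonneg _) hq.le).trans hx
  have h1 := (summable_wellPoisedTerm hq hs0 hs1 hqs hx).mul_left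
    ((1 - s ^ 2 * q * x) * (1 - q * x / s))
  have h2 := (summable_wellPoisedTerm hq hs0 hs1 hqs hxq).mul_left
    ((1 - q * x) * (1 - q * s * x))
  rw [← tsum_mul_left, ← tsum_mul_left, ← sub_eq_zero, ← h1.tsum_sub h2]
  refine tendsto_nhds_unique
    ((tendsto_add_atTop_iff_nat 1).2 (h1.sub h2).hasSum.tendsto_sum_nat) ?_
  simp only [sum_range_wellPoisedTerm hq hs0 hs1 hx]
  have hy := tendsto_pow_atTop_nhds_zero_of_norm_lt_one hq
  -- The boundary term of the telescoping sum vanishes in the limit because ‖q/a‖ < 1.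
  have hw : Tendsto (wellPoisedCore q s x) atTop (𝓝 0) := by
    obtain ⟨C, hC0, hC⟩ := exists_norm_wellPoisedCore_le hq hs0 hs1
    refine squeeze_zero_norm (hC x hx) ?_
    simpa using (tendsto_pow_atTop_nhds_zero_of_lt_one (norm_nonneg _) hqs).const_mul C
  have hA : Tendsto (fun N : ℕ => (1 - s ^ 2 * q ^ N) ^ 2) atTop (𝓝 ((1 - s ^ 2 * 0) ^ 2)) :=
    ((hy.const_mul _).const_sub 1).pow 2
  have hB : Tendsto (fun N : ℕ => (1 - s ^ 2 * q * x * q ^ N)⁻¹) atTop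
      (𝓝 (1 - s ^ 2 * q * x * 0)⁻¹) := ((hy.const_mul _).const_sub 1).inv₀ (by simp)
  simpa only [mul_zero] using ((hA.const_mul (-x * (1 - s ^ 2 * q * x) * (q / s))).mul hB).mul hw

/-- The very-well-poised series at `x` in terms of its value at `0`. -/
lemma tsum_wellPoisedTerm_eq (hq : ‖q‖ < 1) (hs0 : s ≠ 0) (hs1 : ‖s‖ < 1)
    (hqs : ‖q / s ^ 2‖ < 1) (hx : ‖x‖ ≤ ‖s‖⁻¹) :
    qPochInf (s ^ 2 * q * x) q * qPochInf (q * x / s) q * ∑' n, wellPoisedTerm q s x n =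
      qPochInf (q * x) q * qPochInf (q * s * x) q * ∑' n, wellPoisedTerm q s 0 n := by
  have hpow : ∀ m : ℕ, ‖x * q ^ m‖ ≤ ‖s‖⁻¹ := fun m => by
    rw [norm_mul, norm_pow]
    exact (mul_le_of_le_one_right (norm_nonneg _) (pow_le_one₀ (norm_nonneg _) hq.le)).trans hx
  have hiter : ∀ m : ℕ, qPochFin (s ^ 2 * q * x) q m * qPochFin (q * x / s) q m *
      ∑' n, wellPoisedTerm q s x n = qPochFin (q * x) q m * qPochFin (q * s * x) q m *
        ∑' n, wellPoisedTerm q s (x * q ^ m) n := by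
    intro m
    induction m with
    | zero => simp
    | succ m ih =>
      have h := tsum_wellPoisedTerm_contiguous hq hs0 hs1 hqs (hpow m)
      rw [mul_assoc x, ← pow_succ] at h
      simp only [qPochFin_succ]
      linear_combination (1 - s ^ 2 * q * x * q ^ m) * (1 - q * x / s * q ^ m) * ih +
        qPochFin (q * x) q m * qPochFin (q * s * x) q m * h
  have hlim : Tendsto (fun m : ℕ => ∑' n, wellPoisedTerm q s (x * q ^ m) n) atTop
      (𝓝 (∑' n, wellPoisedTerm q s 0 n)) := by
    obtain ⟨C, hC0, hC⟩ := exists_norm_wellPoisedTerm_le hq hs0 hs1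
    refine tendsto_tsum_of_dominated_convergence
      ((summable_geometric_of_lt_one (norm_nonneg _) hqs).mul_left C) (fun n => ?_)
      (Eventually.of_forall fun m => hC _ (hpow m))
    have hcont : ContinuousAt (fun y => wellPoisedTerm q s y n) 0 := by
      unfold wellPoisedTerm wellPoisedCore qPochFin
      refine continuousAt_const.mul (((continuousAt_const.mul ?_).mul
        (ContinuousAt.inv₀ ?_ ?_)).mul continuousAt_const)
      · fun_prop
      · fun_prop
      · simp
    have h0 := (tendsto_pow_atTop_nhds_zero_of_norm_lt_one hq).const_mul x
    rw [mul_zero] at h0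
    exact hcont.tendsto.comp h0
  refine tendsto_nhds_unique
    (((tendsto_qPochFin hq _).mul (tendsto_qPochFin hq _)).mul_const _) ?_
  simp only [hiter]
  exact ((tendsto_qPochFin hq _).mul (tendsto_qPochFin hq _)).mul hlim

/-- The factor x - q⁰ vanishes at x = 1 and kills every term with n ≥ 1. -/
lemma tsum_wellPoisedTerm_one (q s : ℂ) : ∑' n, wellPoisedTerm q s 1 n = 1 + s := by
  rw [tsum_eq_single 0]
  · simp [wellPoisedTerm, wellPoisedCore]
  · intro n hn
    obtain ⟨m, rfl⟩ := Nat.exists_eq_succ_of_ne_zero hn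
    simp [wellPoisedTerm, wellPoisedCore, Finset.prod_range_succ']

/-- At x = s⁻¹ the two products combine to s⁻ⁿ (s;q)ₙ/(sq;q)ₙ, and this quotient of q-products
collapses to (1 - s)/(1 - s qⁿ). -/
lemma wellPoisedTerm_inv (hq : ‖q‖ < 1) (hs0 : s ≠ 0) (hs1 : ‖s‖ < 1) (n : ℕ) :
    wellPoisedTerm q s s⁻¹ n = (1 - s) *
      (qBinomCoeff (s ^ 2) q n ^ 2 * (q / s ^ 2) ^ n * ((1 + s * q ^ n) / (1 - s * q ^ n))) := by
  have hP : ∏ j ∈ Finset.range n, (s⁻¹ - q ^ j) = s⁻¹ ^ n * qPochFin s q n := by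
    have : ∀ j ∈ Finset.range n, s⁻¹ - q ^ j = s⁻¹ * (1 - s * q ^ j) := fun j _ => by field_simp
    rw [Finset.prod_congr rfl this, Finset.prod_mul_distrib, Finset.prod_const, Finset.card_range,
      qPochFin]
  have hsq : s ^ 2 * q * s⁻¹ = s * q := by field_simp
  have hsn : ‖s * q‖ < 1 := by
    rw [norm_mul]; nlinarith [norm_nonneg s, norm_nonneg q]
  have h := (qPochFin_succ s q n).symm.trans (qPochFin_succ' s q n)
  have h1 := qPochFin_ne_zero hq hsn n
  have h2 := one_sub_mul_pow_ne_zero hq hs1 n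
  rw [wellPoisedTerm, wellPoisedCore, hP, hsq, eq_div_of_mul_eq h2 h]
  simp only [div_pow, inv_pow, ← pow_mul]
  field_simp
  ring

/-- The sum of the very-well-poised series at `x = s⁻¹`. -/
theorem tsum_qBinomCoeff_sq_mul (hq : ‖q‖ < 1) (hs0 : s ≠ 0) (hs1 : ‖s‖ < 1)
    (hqs : ‖q / s ^ 2‖ < 1) :
    ∑' n, qBinomCoeff (s ^ 2) q n ^ 2 * (q / s ^ 2) ^ n * ((1 + s * q ^ n) / (1 - s * q ^ n)) =
      qPochInf (s ^ 2) q / qPochInf (q / s ^ 2) q * (qPochInf (q / s) q ^ 2 / qPochInf s q ^ 2) := by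
  have hs : 0 < ‖s‖ := norm_pos_iff.2 hs0
  have h1 := tsum_wellPoisedTerm_eq (x := 1) hq hs0 hs1 hqs
    (by simpa using (one_le_inv₀ hs).2 hs1.le)
  have h2 := tsum_wellPoisedTerm_eq (x := s⁻¹) hq hs0 hs1 hqs (by simp)
  rw [tsum_wellPoisedTerm_one] at h1
  rw [tsum_congr (wellPoisedTerm_inv hq hs0 hs1), tsum_mul_left] at h2
  set I := ∑' n, qBinomCoeff (s ^ 2) q n ^ 2 * (q / s ^ 2) ^ n *
    ((1 + s * q ^ n) / (1 - s * q ^ n))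
  rw [show s ^ 2 * q * s⁻¹ = s * q by field_simp, show q * s⁻¹ / s = q / s ^ 2 by field_simp,
    show q * s⁻¹ = q / s by rfl, show q * s * s⁻¹ = q by field_simp] at h2
  simp only [mul_one] at h1
  rw [mul_comm q s] at h1
  have hsq1 : ‖s * q‖ < 1 := by
    rw [norm_mul]; nlinarith [norm_nonneg s, norm_nonneg q]
  have e1 := qPochInf_eq_mul hq (s ^ 2)
  have e2 := qPochInf_eq_mul hq s
  have n1 := qPochInf_ne_zero hq hq
  have n2 := qPochInf_ne_zero hq hsq1
  have n3 := qPochInf_ne_zero hq hqs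
  have n4 : 1 - s ≠ 0 := by simpa using one_sub_mul_pow_ne_zero hq hs1 0
  rw [e1, e2]
  generalize qPochInf (s ^ 2 * q) q = A at *
  generalize qPochInf (s * q) q = B at *
  generalize qPochInf q q = Q at *
  generalize qPochInf (q / s ^ 2) q = D at *
  generalize qPochInf (q / s) q = E at *
  generalize (∑' n, wellPoisedTerm q s 0 n) = F at *
  field_simp
  -- The relation at x = 1 is solved for F(0), which is then eliminated from the relation at x =
  -- s⁻¹.
  have hF : F = A * E * (1 + s) / (Q * B) := by
    field_simp
    linear_combination -h1
  rw [hF] at h2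
  field_simp at h2
  linear_combination (1 - s) * h2

end

/-! ### Constant terms and the sum over k -/

/-- The constant term of a product of a power series in `z` and a power series in `z⁻¹`. -/
lemma hasSum_circleIntegral_mul_inv {v : ℕ → ℂ} (hv : Summable fun n => ‖v n‖) :
    HasSum (fun n => v n ^ 2) (∮ z in C(0, 1),
      (∑' n, v n * z ^ n) * (∑' n, v n * z⁻¹ ^ n) / (2 * (Real.pi : ℂ) * Complex.I * z)) := by
  set c : ℂ := 2 * (Real.pi : ℂ) * Complex.I with hc
  have hc0 : c ≠ 0 := Complex.two_pi_I_ne_zero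
  have hS : HasSum
      (fun p : ℕ × ℕ => ∮ z in C(0, 1), v p.1 * z ^ p.1 * (v p.2 * z⁻¹ ^ p.2) / (c * z))
      (∮ z in C(0, 1), (∑' n, v n * z ^ n) * (∑' n, v n * z⁻¹ ^ n) / (c * z)) := by
    refine intervalIntegral.hasSum_integral_of_dominated_convergence
      (fun p _ => ‖v p.1‖ * ‖v p.2‖ * ‖c‖⁻¹) (fun p => ?_) (fun p => ?_) ?_ ?_ ?_
    · simp only [deriv_circleMap]
      apply Measurable.aestronglyMeasurable
      fun_prop
    · refine Eventually.of_forall fun θ _ => le_of_eq ?_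
      simp [div_eq_mul_inv, mul_comm, mul_left_comm, mul_assoc]
    · exact Eventually.of_forall fun θ _ => (hv.mul_of_nonneg hv (fun _ => norm_nonneg _)
        fun _ => norm_nonneg _).mul_right _
    · exact intervalIntegrable_const
    · refine Eventually.of_forall fun θ _ => HasSum.const_smul _ (HasSum.div_const ?_ _)
      have h1 : Summable fun n => ‖v n * circleMap 0 1 θ ^ n‖ := by simpa using hv
      have h2 : Summable fun n => ‖v n * (circleMap 0 1 θ)⁻¹ ^ n‖ := by simpa using hv
      have h3 := (summable_mul_of_summable_norm h1 h2).hasSum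
      rwa [← tsum_mul_tsum_of_summable_norm h1 h2] at h3
  have hval : ∀ p : ℕ × ℕ, (∮ z in C(0, 1), v p.1 * z ^ p.1 * (v p.2 * z⁻¹ ^ p.2) / (c * z)) =
      if p.1 = p.2 then v p.1 * v p.2 else 0 := by
    intro p
    have h : (∮ z in C(0, 1), v p.1 * z ^ p.1 * (v p.2 * z⁻¹ ^ p.2) / (c * z)) =
        ∮ z in C(0, 1), v p.1 * v p.2 * c⁻¹ * (z - 0) ^ ((p.1 : ℤ) - p.2 - 1) := by
      refine circleIntegral.integral_congr zero_le_one fun z hz => ?_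
      have hz0 : z ≠ 0 := by rintro rfl; simp at hz
      simp only [sub_zero]
      rw [zpow_sub₀ hz0, zpow_sub₀ hz0]
      simp only [zpow_natCast, zpow_one, inv_pow]
      field_simp
    rw [h, circleIntegral.integral_const_mul]
    -- Only the exponent -1, that is the diagonal of ℕ × ℕ, has a nonzero integral.
    split_ifs with hp
    · simp only [hp, sub_self, zero_sub, zpow_neg, zpow_one]
      rw [circleIntegral.integral_sub_center_inv _ one_ne_zero, ← hc]
      field_simp
    · rw [circleIntegral.integral_sub_zpow_of_ne (by omega), mul_zero]
  simp only [hval] at hS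
  have hinj : Function.Injective fun n : ℕ => (n, n) := fun m n h => congrArg Prod.fst h
  refine ((hinj.hasSum_iff fun p hp => if_neg fun h => hp ⟨p.1, Prod.ext rfl h⟩).2 hS).congr_fun ?_
  intro n
  simp [sq]

lemma hasSum_pow_natAbs {y : ℂ} (hy : ‖y‖ < 1) :
    HasSum (fun k : ℤ => y ^ k.natAbs) ((1 + y) / (1 - y)) := by
  have h := hasSum_geometric_of_norm_lt_one hy
  have h' : HasSum (fun k : ℤ => y ^ k.natAbs) _ :=
    -- Both half-sums contain k = 0, so the value is 2/(1 - y) - 1.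
    HasSum.of_nat_of_neg (by simpa using h) (by simpa using h)
  convert h' using 1
  have : 1 - y ≠ 0 := by simpa using one_sub_mul_pow_ne_zero (q := 0) (by simp) hy 0
  simp
  field_simp
  ring

section
variable {q r s : ℂ}

/-- This is where ‖q/a‖ < 1 enters: it keeps the denominators free of zeros on the circle and makes
both expansions converge there. -/
lemma norm_inv_mul_pow_lt_one (hq : ‖q‖ < 1) (hr : r ^ 2 = q)
    (hqs : ‖q / s ^ 2‖ < 1) (m : ℕ) : ‖s⁻¹ * r ^ (1 + m)‖ < 1 := by
  have hr1 : ‖r‖ < 1 := by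
    rw [← hr, norm_pow] at hq
    exact (sq_lt_one_iff₀ (norm_nonneg _)).1 hq
  have hrs : ‖s⁻¹ * r‖ < 1 := by
    rw [← hr, ← div_pow, norm_pow] at hqs
    rw [inv_mul_eq_div]
    exact (sq_lt_one_iff₀ (norm_nonneg _)).1 hqs
  rw [pow_add, pow_one, ← mul_assoc, norm_mul, norm_pow]
  exact mul_lt_one_of_nonneg_of_lt_one_left (norm_nonneg _) hrs
    (pow_le_one₀ (norm_nonneg _) hr1.le)

lemma qPochInfPM_ne_zero {c z : ℂ} (hq : ‖q‖ < 1) (hc : ‖c‖ < 1) (hz : ‖z‖ = 1) :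
    qPochInfPM c z q ≠ 0 :=
  mul_ne_zero (qPochInf_ne_zero hq (by simpa [hz] using hc))
    (qPochInf_ne_zero hq (by simpa [hz] using hc))

lemma continuousOn_qPochInfPM (hq : ‖q‖ < 1) (c : ℂ) :
    ContinuousOn (fun z => qPochInfPM c z q) (Metric.sphere 0 1) := by
  have hinv : ContinuousOn (fun z : ℂ => c * z⁻¹) (Metric.sphere 0 1) :=
    continuousOn_const.mul (continuousOn_inv₀.mono fun z hz => by rintro rfl; simp at hz)
  exact ((continuous_qPochInf hq).comp (continuous_const.mul continuous_id)).continuousOn.mul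
    ((continuous_qPochInf hq).comp_continuousOn hinv)

lemma hasSum_electricTerm (hq : ‖q‖ < 1) (hr : r ^ 2 = q) (hs0 : s ≠ 0)
    (hqs : ‖q / s ^ 2‖ < 1) (k : ℤ) :
    HasSum (fun n => qBinomCoeff (s ^ 2) q n ^ 2 * (q / s ^ 2) ^ n * (s * q ^ n) ^ k.natAbs)
      (electricTerm q r s k) := by
  set c := s⁻¹ * r ^ (1 + k.natAbs) with hc
  have hc1 : ‖c‖ < 1 := norm_inv_mul_pow_lt_one hq hr hqs _
  have hsc : s * r ^ (1 + k.natAbs) = s ^ 2 * c := by rw [hc]; field_simp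
  have h := hasSum_circleIntegral_mul_inv (summable_norm_qBinomCoeff_mul_pow hq hc1 (s ^ 2))
  have hint : (∮ z in C(0, 1), (∑' n, qBinomCoeff (s ^ 2) q n * c ^ n * z ^ n) *
      (∑' n, qBinomCoeff (s ^ 2) q n * c ^ n * z⁻¹ ^ n) / (2 * (Real.pi : ℂ) * Complex.I * z)) =
      ∮ z in C(0, 1), electricIntegrand q r s k z / (2 * (Real.pi : ℂ) * Complex.I * z) := by
    refine circleIntegral.integral_congr zero_le_one fun z hz => ?_
    have hz1 : ‖z‖ = 1 := by simpa using hz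
    have b1 := tsum_qBinomCoeff_mul_pow (x := c * z) hq (by simpa [hz1] using hc1) (s ^ 2)
    have b2 := tsum_qBinomCoeff_mul_pow (x := c * z⁻¹) hq (by simpa [hz1] using hc1) (s ^ 2)
    simp only [mul_pow c, ← mul_assoc] at b1 b2
    simp only [b1, b2, electricIntegrand, qPochInfPM, hsc, ← hc, div_mul_div_comm]
  rw [hint] at h
  refine (h.mul_left (s ^ k.natAbs)).congr_fun fun n => ?_
  -- Squaring removes the choice of the root r, and the dependence on k becomes q^(n|k|).
  have hcsq : c ^ 2 = q / s ^ 2 * q ^ k.natAbs := by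
    rw [hc, mul_pow, ← pow_mul, mul_comm (1 + k.natAbs), pow_mul, hr, pow_add]
    field_simp
  have : (qBinomCoeff (s ^ 2) q n * c ^ n) ^ 2 = qBinomCoeff (s ^ 2) q n ^ 2 * (c ^ 2) ^ n := by
    ring
  rw [this, hcsq]
  ring

/-- Domination by B² ‖s‖^|k| ‖q/a‖ⁿ gives absolute convergence, which allows the exchange of the
sums over k and n. -/
lemma summable_electric_double (hq : ‖q‖ < 1) (hs1 : ‖s‖ < 1) (hqs : ‖q / s ^ 2‖ < 1) :
    Summable fun p : ℤ × ℕ =>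
      qBinomCoeff (s ^ 2) q p.2 ^ 2 * (q / s ^ 2) ^ p.2 * (s * q ^ p.2) ^ p.1.natAbs := by
  obtain ⟨B, hB0, hB⟩ := exists_norm_qBinomCoeff_le hq (s ^ 2)
  have h1 : Summable fun k : ℤ => ‖s‖ ^ k.natAbs := by
    simpa using (hasSum_pow_natAbs hs1).summable.norm
  have h2 : Summable fun n : ℕ => B ^ 2 * ‖q / s ^ 2‖ ^ n :=
    (summable_geometric_of_lt_one (norm_nonneg _) hqs).mul_left _
  refine Summable.of_norm_bounded (h1.mul_of_nonneg h2 (fun _ => by positivity)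
    fun _ => by positivity) fun p => ?_
  have hle : ‖s * q ^ p.2‖ ≤ ‖s‖ := by
    rw [norm_mul, norm_pow]
    exact mul_le_of_le_one_right (norm_nonneg _) (pow_le_one₀ (norm_nonneg _) hq.le)
  rw [norm_mul, norm_mul, norm_pow, norm_pow, norm_pow, mul_comm]
  gcongr
  exact hB _

lemma hasSum_electricIndex (hq : ‖q‖ < 1) (hr : r ^ 2 = q) (hs0 : s ≠ 0) (hs1 : ‖s‖ < 1)
    (hqs : ‖q / s ^ 2‖ < 1) :
    HasSum (electricTerm q r s) (∑' n, qBinomCoeff (s ^ 2) q n ^ 2 * (q / s ^ 2) ^ n *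
      ((1 + s * q ^ n) / (1 - s * q ^ n))) := by
  have hsum := (summable_electric_double hq hs1 hqs).hasSum
  have h1 := hsum.prod_fiberwise fun k => hasSum_electricTerm hq hr hs0 hqs k
  have h2 := ((Equiv.prodComm ℕ ℤ).hasSum_iff.2 hsum).prod_fiberwise fun n =>
    (hasSum_pow_natAbs (y := s * q ^ n) (by
      rw [norm_mul, norm_pow]
      exact mul_lt_one_of_nonneg_of_lt_one_left (norm_nonneg _) hs1
        (pow_le_one₀ (norm_nonneg _) hq.le))).mul_left
      (qBinomCoeff (s ^ 2) q n ^ 2 * (q / s ^ 2) ^ n)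
  rwa [h2.tsum_eq]

end

theorem theorem2 (q h a r s : ℂ) (hq0 : q ≠ 0) (hq1 : ‖q‖ < 1)
    (ha : a = q ^ (1 - h)) (hr : r ^ 2 = q) (hs : s ^ 2 = a)
    (hqa : ‖q / a‖ < 1) (ha1 : ‖a‖ < 1) :
    (∀ k : ℤ, ∀ z ∈ Metric.sphere (0 : ℂ) 1,
        qPochInfPM (s⁻¹ * r ^ (1 + k.natAbs)) z q ≠ 0) ∧
      (∀ k : ℤ, ContinuousOn (electricIntegrand q r s k) (Metric.sphere (0 : ℂ) 1)) ∧
      Summable (electricTerm q r s) ∧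
      qPochInf (q / a) q ≠ 0 ∧ qPochInf s q ≠ 0 ∧
      electricIndex q r s = mirrorIndex q a s := by
  -- The exponent h matters only through a ≠ 0.
  have ha0 : a ≠ 0 := by rw [ha]; simp [Complex.cpow_eq_zero_iff, hq0]
  subst hs
  have hs0 : s ≠ 0 := fun h0 => ha0 (by simp [h0])
  have hs1 : ‖s‖ < 1 := by
    rw [norm_pow] at ha1
    exact (sq_lt_one_iff₀ (norm_nonneg _)).1 ha1
  have hden : ∀ k : ℤ, ∀ z ∈ Metric.sphere (0 : ℂ) 1,
      qPochInfPM (s⁻¹ * r ^ (1 + k.natAbs)) z q ≠ 0 := fun k z hz =>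
    qPochInfPM_ne_zero hq1 (norm_inv_mul_pow_lt_one hq1 hr hqa _) (by simpa using hz)
  have hsum := hasSum_electricIndex hq1 hr hs0 hs1 hqa
  exact ⟨hden, fun k => (continuousOn_qPochInfPM hq1 _).div (continuousOn_qPochInfPM hq1 _) (hden k),
    hsum.summable, qPochInf_ne_zero hq1 hqa, qPochInf_ne_zero hq1 hs1,
    hsum.tsum_eq.trans (tsum_qBinomCoeff_sq_mul hq1 hs0 hs1 hqa)⟩
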